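/- Let $\mathcal H=\mathbb C^n$ with computational basis $(|i\rangle)_i$. A density operator is a positive semidefinite operator of trace $1$; a partial density operator is a positive semidefinite operator of trace at most $1$. A superoperator over $\mathcal H$ is a completely positive, trace-non-increasing linear map on the operators on $\mathcal H$. Let $\mathcal E,\mathcal E'$ be superoperators over $\mathcal H$, let $0\sqsubseteq Q\sqsubseteq I$ be a quantum predicate on $\mathcal H$, let $0\le\lambda\le 1$, and assume that some density operator $\sigma$ on $\mathcal H$ satisfies $\operatorname{tr}(Q\sigma)\ge\lambda$. The $(Q,\lambda)$-diamond norm is $$\|\mathcal E-\mathcal E'\|_{Q,\lambda}=\max\Big\{\tfrac12\big\|(\mathcal E\otimes \mathcal I_{\mathcal A})(\rho)-(\mathcal E'\otimes \mathcal I_{\mathcal A})(\rho)\big\|_1\Big\},$$ where the maximum is over all finite-dimensional auxiliary spaces $\mathcal A$ and all density operators $\rho$ on $\mathcal H\otimes\mathcal A$ with $\operatorname{tr}((Q\otimes I_{\mathcal A})\rho)\ge\lambda$, and where $\|\cdot\|_1$ is the trace norm. Put $\Phi=\mathcal E-\mathcal E'$ and let $J(\Phi)=\sum_{i,j}\Phi(|i\rangle\langle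 j|)\otimes|i\rangle\langle j|$ be its Choi–Jamiołkowski matrix. Then the maximum defining $\|\mathcal E-\mathcal E'\|_{Q,\lambda}$ is attained, and the following hold. 1. If $\operatorname{tr}\mathcal E(X)=\operatorname{tr}\mathcal E'(X)$ for every operator $X$ (for instance, if $\mathcal E$ and $\mathcal E'$ are trace-preserving), then $\|\mathcal E-\mathcal E'\|_{Q,\lambda}$ is the (attained) optimum of the semidefinite program $$\text{maximize } \operatorname{tr}(J(\Phi)W)\quad\text{subject to}\quad 0\sqsubseteq W\sqsubseteq I_{\mathcal H}\otimes\rho,\quad \operatorname{tr}(Q^{T}\rho)\ge\lambda,\quad \rho\text{ a density operator on }\mathcal H,$$ where $W$ is an operator on $\mathcal H\otimes\mathcal H$ and $Q^{T}$ is the transpose of $Q$ in the computational basis (so $Q^T=Q$ if $Q$ is a real matrix). 2. For arbitrary superoperators $\mathcal E,\mathcal E'$, $\|\mathcal E-\mathcal E'\|_{Q,\lambda}$ is the (attained) optimum of the semidefinite program with the same constraints and the objective $\operatorname{tr}\big(J(\Phi)(W-\tfrac12 I_{\mathcal H}\otimes\rho)\big)$. In both parts the optimum is the same, and also attained, if $\rho$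 is allowed to range over all partial density operators on $\mathcal H$. -/

import Mathlib

open scoped Kronecker ComplexOrder

namespace QDiamond

/-! Operators on a finite-dimensional Hilbert space `H = ℂⁿ` are `Matrix n n ℂ`, with `n` a finite
index type for the computational basis; operators on `H ⊗ A` are matrices indexed by pairs. -/

/-- Density operators: positive semidefinite with trace `1`. -/
def densityOperators (n : Type*) [Fintype n] : Set (Matrix n n ℂ) :=
  {ρ | ρ.PosSemidef ∧ ρ.trace = 1}

/-- Partial density operators: positive semidefinite with trace at most `1`. -/
def partialDensityOperators (n : Type*) [Fintype n] : Set (Matrix n n ℂ) :=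
  {ρ | ρ.PosSemidef ∧ ρ.trace.re ≤ 1}

/-- Quantum predicates: Hermitian operators `Q` with `0 ⊑ Q ⊑ I` in the Löwner order. -/
def IsQuantumPredicate {n : Type*} [DecidableEq n] (Q : Matrix n n ℂ) : Prop :=
  Q.PosSemidef ∧ (1 - Q).PosSemidef

/-- The map `E ⊗ I_A`, where `A` has basis `k`: for basis indices `x y` of `A`, the `(x, y)` block of
the output is `E` applied to the `(x, y)` block of the input. -/
def ampliate {n : Type*} (E : Matrix n n ℂ →ₗ[ℂ] Matrix n n ℂ) (k : Type*)
    (M : Matrix (n × k) (n × k) ℂ) : Matrix (n × k) (n × k) ℂ :=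
  Matrix.of fun p q => E (Matrix.of fun i j => M (i, p.2) (j, q.2)) p.1 q.1

theorem ampliate_kronecker {n k : Type*} (E : Matrix n n ℂ →ₗ[ℂ] Matrix n n ℂ)
    (X : Matrix n n ℂ) (Y : Matrix k k ℂ) : ampliate E k (X ⊗ₖ Y) = E X ⊗ₖ Y := by
  ext ⟨a, x⟩ ⟨b, y⟩
  have h : (Matrix.of fun i j => (X ⊗ₖ Y) (i, x) (j, y)) = Y x y • X := by
    ext i j
    simp [mul_comm]
  simp only [ampliate, Matrix.of_apply]
  rw [h]
  simp [mul_comm]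

/-- Superoperators over `H`: completely positive, trace-non-increasing linear maps. -/
structure IsSuperoperator {n : Type*} [Fintype n]
    (E : Matrix n n ℂ →ₗ[ℂ] Matrix n n ℂ) : Prop where
  completelyPositive : ∀ (k : ℕ) (M : Matrix (n × Fin k) (n × Fin k) ℂ),
    M.PosSemidef → (ampliate E (Fin k) M).PosSemidef
  traceNonincreasing : ∀ ρ ∈ partialDensityOperators n, (E ρ).trace.re ≤ ρ.trace.re

/-- The trace norm of a Hermitian operator: the sum of the absolute values of its eigenvalues,
counted with multiplicity. -/
noncomputable def traceNorm {m : Type*} [Fintype m] [DecidableEq m] (A : Matrix m m ℂ) : ℝ :=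
  (A.charpoly.roots.map fun z => ‖z‖).sum

/-- The trace distance `T(ρ, σ) = ½ ‖ρ - σ‖₁`. -/
noncomputable def traceDist {m : Type*} [Fintype m] [DecidableEq m] (ρ σ : Matrix m m ℂ) : ℝ :=
  1 / 2 * traceNorm (ρ - σ)

/-- The values `T((E ⊗ I_A)(ρ), (E' ⊗ I_A)(ρ))`, over all finite-dimensional auxiliary spaces `A`
and all density operators `ρ` on `H ⊗ A` with `tr((Q ⊗ I_A) ρ) ≥ lam`. -/
def qDiamondValues {n : Type*} [Fintype n] [DecidableEq n]
    (E E' : Matrix n n ℂ →ₗ[ℂ] Matrix n n ℂ) (Q : Matrix n n ℂ) (lam : ℝ) : Set ℝ :=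
  {t | ∃ k : ℕ, ∃ ρ ∈ densityOperators (n × Fin k),
    lam ≤ ((Q ⊗ₖ (1 : Matrix (Fin k) (Fin k) ℂ)) * ρ).trace.re ∧
    t = traceDist (ampliate E (Fin k) ρ) (ampliate E' (Fin k) ρ)}

/-- The `(Q, lam)`-diamond norm `‖E - E'‖_{Q, lam}`. -/
noncomputable def qDiamondNorm {n : Type*} [Fintype n] [DecidableEq n]
    (E E' : Matrix n n ℂ →ₗ[ℂ] Matrix n n ℂ) (Q : Matrix n n ℂ) (lam : ℝ) : ℝ :=
  sSup (qDiamondValues E E' Q lam)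

/-- The Choi–Jamiołkowski matrix `J(Φ) = ∑ i j, Φ(|i⟩⟨j|) ⊗ |i⟩⟨j|`; the first tensor factor is the
output of `Φ`, the second one its input. -/
def choi {n : Type*} [Fintype n] [DecidableEq n]
    (Φ : Matrix n n ℂ →ₗ[ℂ] Matrix n n ℂ) : Matrix (n × n) (n × n) ℂ :=
  ∑ i, ∑ j, Φ (Matrix.single i j 1) ⊗ₖ Matrix.single i j 1

/-- The constraints `0 ⊑ W ⊑ I ⊗ ρ` and `tr(P ρ) ≥ lam` of the semidefinite program. -/
def SDPConstraints {n : Type*} [Fintype n] [DecidableEq n] (P : Matrix n n ℂ) (lam : ℝ)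
    (ρ : Matrix n n ℂ) (W : Matrix (n × n) (n × n) ℂ) : Prop :=
  W.PosSemidef ∧ ((1 : Matrix n n ℂ) ⊗ₖ ρ - W).PosSemidef ∧ lam ≤ (P * ρ).trace.re

/-- The objective values `tr(J W)` over all feasible `(ρ, W)` with `ρ` in the set `D`. -/
def sdpValues {n : Type*} [Fintype n] [DecidableEq n] (D : Set (Matrix n n ℂ))
    (J : Matrix (n × n) (n × n) ℂ) (P : Matrix n n ℂ) (lam : ℝ) : Set ℝ :=
  {v | ∃ ρ ∈ D, ∃ W, SDPConstraints P lam ρ W ∧ v = (J * W).trace.re}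

/-- The values of the centered objective `tr(J (W - ½ I ⊗ ρ))` over all feasible `(ρ, W)` with `ρ` in
the set `D`. -/
def centeredSDPValues {n : Type*} [Fintype n] [DecidableEq n] (D : Set (Matrix n n ℂ))
    (J : Matrix (n × n) (n × n) ℂ) (P : Matrix n n ℂ) (lam : ℝ) : Set ℝ :=
  {v | ∃ ρ ∈ D, ∃ W, SDPConstraints P lam ρ W ∧
    v = (J * (W - (1 / 2 : ℂ) • ((1 : Matrix n n ℂ) ⊗ₖ ρ))).trace.re}

end QDiamond

/-!
The trace norm of a Hermitian operator `A` is controlled by effects `0 ⊑ P ⊑ 1`: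
`½ ‖A‖₁ = max_P (tr(P A) - ½ tr A)` (`centered_trace_le_traceNorm`, `exists_effect_eq_traceNorm`).

Write a positive operator on `H ⊗ A` as `∑ l, |C l⟫⟪C l|` with matrices `C l`, and put
`T l = I ⊗ C l`. Then `(Φ ⊗ I_A)(∑ l, |C l⟫⟪C l|) = ∑ l, T l J(Φ) (T l)ᴴ` (`ampliate_mixture`), and
`ρ = ∑ l, (C l)ᴴ C l` is the transposed reduced operator on `H`, which turns the constraint on `Q`
into one on `Qᵀ`. Hence an effect `P` on `H ⊗ A` corresponds to `W = ∑ l, (T l)ᴴ P (T l)`, which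
satisfies `0 ⊑ W ⊑ I ⊗ ρ`, and the objective `tr(J (W - ½ I ⊗ ρ))` equals the centered expectation
of `P` (`centered_objective_eq`). So every trace distance in the definition of the norm is a value of
the centered program. Conversely a feasible `W ⊑ I ⊗ ρ = Tᴴ T`, with `T = I ⊗ C` and `Cᴴ C = ρ`,
factors as `Tᴴ P T` for an effect `P` (`exists_effect_factorization`), so its value is at most the
trace distance on the pure state `|C⟫⟪C|`.

The feasible set with density operators is compact, so the centered program attains its maximum,
and by the two comparisons this is also the attained maximum of the trace distances. Partial density
operators are completed to density operators without decreasing the objective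
(`exists_centeredSDPValue_ge_of_partial`). If `Φ` has traceless outputs, the centering term vanishes
and the two objectives agree (`centeredSDPValues_eq_sdpValues`).
-/

namespace QDiamond

open Matrix

/-! ### Effects, the trace norm and Douglas' factorization -/

section Spectral

variable {m p : Type*} [Fintype m] [Fintype p] [DecidableEq m] [DecidableEq p]

theorem exists_conjTranspose_mul_self {A : Matrix m m ℂ} (hA : A.PosSemidef) :
    ∃ V : Matrix m m ℂ, A = Vᴴ * V := by
  open scoped MatrixOrder in
  exact CStarAlgebra.nonneg_iff_eq_star_mul_self.mp hA.nonneg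

theorem trace_mul_nonneg {A B : Matrix m m ℂ} (hA : A.PosSemidef) (hB : B.PosSemidef) :
    0 ≤ (A * B).trace.re := by
  obtain ⟨V, rfl⟩ := exists_conjTranspose_mul_self hA
  rw [Matrix.mul_assoc, Matrix.trace_mul_comm]
  exact (Complex.le_def.mp (hB.mul_mul_conjTranspose_same V).trace_nonneg).1

theorem exists_unitary_diagonalization {A : Matrix m m ℂ} (hA : A.IsHermitian) :
    ∃ U : Matrix m m ℂ, Uᴴ * U = 1 ∧ U * Uᴴ = 1 ∧
      A = U * diagonal (fun i => (hA.eigenvalues i : ℂ)) * Uᴴ := by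
  refine ⟨hA.eigenvectorUnitary, ?_, ?_, ?_⟩
  · exact Unitary.coe_star_mul_self hA.eigenvectorUnitary
  · exact Unitary.coe_mul_star_self hA.eigenvectorUnitary
  · exact hA.spectral_theorem

theorem traceNorm_eq_sum_abs_eigenvalues {A : Matrix m m ℂ} (hA : A.IsHermitian) :
    traceNorm A = ∑ i, |hA.eigenvalues i| := by
  rw [traceNorm, hA.roots_charpoly_eq_eigenvalues, Multiset.map_map]
  refine congrArg Multiset.sum (Multiset.map_congr rfl fun i _ => ?_)
  simp

theorem trace_mul_conj_diagonal (P U : Matrix m m ℂ) (d : m → ℝ) :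
    (P * (U * diagonal (fun i => (d i : ℂ)) * Uᴴ)).trace.re
      = ∑ i, ((Uᴴ * P * U) i i).re * d i := by
  rw [← Matrix.mul_assoc, Matrix.trace_mul_comm, ← Matrix.mul_assoc, ← Matrix.mul_assoc]
  simp [Matrix.trace, Matrix.mul_diagonal]

/-- With `A` diagonal in the basis `U`, the centered expectation of `P` is `∑ i, (pᵢ - ½) dᵢ`, where
`pᵢ` are the diagonal entries of `P` in that basis. -/
theorem centered_trace_eq_sum {A U : Matrix m m ℂ} {d : m → ℝ} (hU : Uᴴ * U = 1)
    (h : A = U * diagonal (fun i => (d i : ℂ)) * Uᴴ) (P : Matrix m m ℂ) :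
    (P * A).trace.re - 1 / 2 * A.trace.re
      = ∑ i, (((Uᴴ * P * U) i i).re - 1 / 2) * d i := by
  have h1 := trace_mul_conj_diagonal (1 : Matrix m m ℂ) U d
  rw [Matrix.one_mul, Matrix.mul_one, hU, ← h] at h1
  rw [h1, h, trace_mul_conj_diagonal, Finset.mul_sum, ← Finset.sum_sub_distrib]
  refine Finset.sum_congr rfl fun i _ => ?_
  simp
  ring

/-- An effect `P` never distinguishes better than half of the trace norm. -/
theorem centered_trace_le_traceNorm {A P : Matrix m m ℂ} (hA : A.IsHermitian)
    (hP : P.PosSemidef) (hP' : (1 - P).PosSemidef) :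
    (P * A).trace.re - 1 / 2 * A.trace.re ≤ 1 / 2 * traceNorm A := by
  obtain ⟨U, hU, -, h⟩ := exists_unitary_diagonalization hA
  rw [centered_trace_eq_sum hU h, traceNorm_eq_sum_abs_eigenvalues hA, Finset.mul_sum]
  refine Finset.sum_le_sum fun i _ => ?_
  have h0 : 0 ≤ ((Uᴴ * P * U) i i).re :=
    (Complex.le_def.mp (hP.conjTranspose_mul_mul_same U).diag_nonneg).1
  have h1 : ((Uᴴ * P * U) i i).re ≤ 1 := by
    have := (Complex.le_def.mp ((hP'.conjTranspose_mul_mul_same U).diag_nonneg (i := i))).1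
    rw [Matrix.mul_sub, Matrix.sub_mul, Matrix.mul_one, hU] at this
    simpa using this
  calc _ ≤ |(((Uᴴ * P * U) i i).re - 1 / 2) * hA.eigenvalues i| := le_abs_self _
    _ ≤ _ := by
      rw [abs_mul]
      exact mul_le_mul_of_nonneg_right (abs_le.mpr ⟨by linarith, by linarith⟩) (abs_nonneg _)

/-- The projection onto the nonnegative eigenspaces attains half of the trace norm. -/
theorem exists_effect_eq_traceNorm {A : Matrix m m ℂ} (hA : A.IsHermitian) :
    ∃ P : Matrix m m ℂ, P.PosSemidef ∧ (1 - P).PosSemidef ∧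
      (P * A).trace.re - 1 / 2 * A.trace.re = 1 / 2 * traceNorm A := by
  obtain ⟨U, hU, hU', h⟩ := exists_unitary_diagonalization hA
  set d := hA.eigenvalues with hd
  set e : m → ℂ := fun i => if 0 ≤ d i then 1 else 0 with he
  refine ⟨U * diagonal e * Uᴴ, ?_, ?_, ?_⟩
  · refine (PosSemidef.diagonal fun i => ?_).mul_mul_conjTranspose_same U
    by_cases hi : 0 ≤ d i <;> simp [he, hi]
  · have : 1 - U * diagonal e * Uᴴ = U * diagonal (1 - e) * Uᴴ := by
      have h1 : diagonal (1 - e) = 1 - diagonal e := by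
        rw [← diagonal_one, diagonal_sub]; rfl
      rw [h1, Matrix.mul_sub, Matrix.sub_mul, Matrix.mul_one, hU']
    rw [this]
    refine (PosSemidef.diagonal fun i => ?_).mul_mul_conjTranspose_same U
    by_cases hi : 0 ≤ d i <;> simp [he, hi]
  · have hE : Uᴴ * (U * diagonal e * Uᴴ) * U = diagonal e := by
      calc _ = (Uᴴ * U) * diagonal e * (Uᴴ * U) := by simp only [Matrix.mul_assoc]
        _ = _ := by simp [hU]
    rw [centered_trace_eq_sum hU h, hE, traceNorm_eq_sum_abs_eigenvalues hA, Finset.mul_sum]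
    refine Finset.sum_congr rfl fun i _ => ?_
    by_cases hi : 0 ≤ d i
    · rw [abs_of_nonneg hi, diagonal_apply_eq, show e i = 1 from if_pos hi, Complex.one_re]
      ring
    · rw [abs_of_neg (not_le.mp hi), diagonal_apply_eq, show e i = 0 from if_neg hi, Complex.zero_re]
      ring

/-- A Hermitian matrix has a Hermitian pseudo-inverse. -/
theorem exists_pseudoinverse {M : Matrix m m ℂ} (hM : M.IsHermitian) :
    ∃ N : Matrix m m ℂ, N.IsHermitian ∧ M * N * M = M ∧ N * M * N = N := by
  obtain ⟨U, hU, -, h⟩ := exists_unitary_diagonalization hM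
  set d : m → ℂ := fun i => (hM.eigenvalues i : ℂ) with hd
  have key : ∀ a b : m → ℂ, (U * diagonal a * Uᴴ) * (U * diagonal b * Uᴴ)
      = U * diagonal (a * b) * Uᴴ := by
    intro a b
    calc _ = U * diagonal a * (Uᴴ * U) * diagonal b * Uᴴ := by simp only [Matrix.mul_assoc]
      _ = U * (diagonal a * diagonal b) * Uᴴ := by rw [hU, Matrix.mul_one, Matrix.mul_assoc U]
      _ = _ := by rw [diagonal_mul_diagonal]; rfl
  -- `0⁻¹ = 0`, so `d⁻¹` inverts exactly the nonzero eigenvalues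
  refine ⟨U * diagonal d⁻¹ * Uᴴ, ?_, ?_, ?_⟩
  · refine isHermitian_mul_mul_conjTranspose U (isHermitian_diagonal_of_self_adjoint _ ?_)
    ext i
    simp [hd]
  all_goals
    rw [h, key, key]
    congr 3
    ext i
    by_cases hi : d i = 0 <;> simp [hi]

/-- A matrix version of Douglas' factorization lemma: a positive semidefinite `W ⊑ Tᴴ T` factors as
`Tᴴ P T` with `0 ⊑ P ⊑ 1`. With `N` a pseudo-inverse of `Tᴴ T`, the effect is `P = T N W N Tᴴ`. -/
theorem exists_effect_factorization {T : Matrix p m ℂ} {W : Matrix m m ℂ} (hW : W.PosSemidef)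
    (hWT : (Tᴴ * T - W).PosSemidef) :
    ∃ P : Matrix p p ℂ, P.PosSemidef ∧ (1 - P).PosSemidef ∧ W = Tᴴ * P * T := by
  obtain ⟨N, hN, hMNM, hNMN⟩ := exists_pseudoinverse (isHermitian_conjTranspose_mul_self T)
  set M := Tᴴ * T with hM
  have hP : T * N * W * (T * N)ᴴ = T * N * W * N * Tᴴ := by
    rw [conjTranspose_mul, hN.eq, ← Matrix.mul_assoc]
  -- `W` vanishes on the kernel of `M`, since `0 ⊑ W ⊑ M`
  have hWX : W * (1 - N * M) = 0 := by
    have hMX : M * (1 - N * M) = 0 := by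
      rw [Matrix.mul_sub, Matrix.mul_one, ← Matrix.mul_assoc, hMNM, sub_self]
    obtain ⟨V, rfl⟩ := exists_conjTranspose_mul_self hW
    have h1 := hWT.conjTranspose_mul_mul_same (1 - N * M)
    rw [Matrix.mul_assoc, Matrix.sub_mul, hMX, zero_sub] at h1
    have h2 : (V * (1 - N * M))ᴴ * (V * (1 - N * M)) = 0 := by
      have h3 := posSemidef_conjTranspose_mul_self (V * (1 - N * M))
      refine h3.trace_eq_zero_iff.mp (le_antisymm ?_ h3.trace_nonneg)
      have h4 := h1.trace_nonneg
      rw [Matrix.mul_neg, trace_neg, neg_nonneg] at h4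
      simpa only [conjTranspose_mul, Matrix.mul_assoc] using h4
    rw [Matrix.mul_assoc, conjTranspose_mul_self_eq_zero.mp h2, Matrix.mul_zero]
  have hWNM : W * (N * M) = W := by
    rw [Matrix.mul_sub, Matrix.mul_one, sub_eq_zero] at hWX
    exact hWX.symm
  have hMNW : M * N * W = W := by
    have := congrArg conjTranspose hWNM
    rwa [conjTranspose_mul, conjTranspose_mul, hN.eq, hW.isHermitian.eq,
      (isHermitian_conjTranspose_mul_self T).eq] at this
  refine ⟨T * N * W * N * Tᴴ, hP ▸ hW.mul_mul_conjTranspose_same (T * N), ?_, ?_⟩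
  · -- `1 - P` is the sum of `T N (M - W) N Tᴴ` and the projection `1 - T N Tᴴ`
    have h1 := hWT.mul_mul_conjTranspose_same (T * N)
    have h2 := posSemidef_self_mul_conjTranspose (1 - T * N * Tᴴ)
    have h3 : (T * N * Tᴴ) * (T * N * Tᴴ) = T * N * Tᴴ := by
      calc _ = T * (N * M * N) * Tᴴ := by simp only [hM, Matrix.mul_assoc]
        _ = _ := by rw [hNMN]
    have h4 : (1 - T * N * Tᴴ)ᴴ = 1 - T * N * Tᴴ := by
      simp [conjTranspose_sub, hN.eq, Matrix.mul_assoc]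
    rw [h4] at h2
    convert h1.add h2 using 1
    have h5 : T * N * M * (T * N)ᴴ = T * N * Tᴴ := by
      calc _ = T * (N * M * N) * Tᴴ := by
            rw [conjTranspose_mul, hN.eq]; simp only [Matrix.mul_assoc]
        _ = _ := by rw [hNMN]
    rw [Matrix.mul_sub, Matrix.sub_mul, h5, hP, Matrix.mul_sub, Matrix.sub_mul, Matrix.sub_mul, h3]
    simp
  · calc W = M * N * W * (N * M) := by rw [hMNW, hWNM]
      _ = _ := by simp only [hM, Matrix.mul_assoc]

omit [Fintype m] [DecidableEq m] in
theorem norm_entry_le_one {M : Matrix m m ℂ} (hM : M.PosSemidef) (h : ∀ i, (M i i).re ≤ 1)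
    (i j : m) : ‖M i j‖ ≤ 1 := by
  -- the `2 × 2` principal minor on `i`, `j` is nonnegative
  have h1 := (Complex.le_def.mp (hM.submatrix ![i, j]).det_nonneg).1
  have h2 : M j i = star (M i j) := (hM.isHermitian.apply j i).symm
  obtain ⟨hi, hi'⟩ := Complex.le_def.mp (hM.diag_nonneg (i := i))
  obtain ⟨hj, hj'⟩ := Complex.le_def.mp (hM.diag_nonneg (i := j))
  rw [det_fin_two] at h1
  simp only [submatrix_apply, cons_val_zero, cons_val_one, h2, Complex.sub_re, Complex.mul_re,
    Complex.zero_re, ← hi', Complex.zero_im, zero_mul, sub_zero, Complex.star_def,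
    Complex.conj_re, Complex.conj_im] at h1 hi hj
  have h3 : ‖M i j‖ ^ 2 = (M i j).re * (M i j).re + (M i j).im * (M i j).im := by
    rw [← Complex.normSq_eq_norm_sq, Complex.normSq_apply]
  have h4 := mul_le_mul (h i) (h j) hj zero_le_one
  exact (sq_le_one_iff₀ (norm_nonneg _)).mp (by linarith)

omit [DecidableEq m] in
theorem isClosed_posSemidef : IsClosed {M : Matrix m m ℂ | M.PosSemidef} := by
  simp only [posSemidef_iff_dotProduct_mulVec, Set.ofPred_and, Set.ofPred_forall, IsHermitian]
  refine IsClosed.inter (isClosed_eq (by fun_prop) (by fun_prop)) (isClosed_iInter fun x => ?_)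
  exact isClosed_le continuous_const (by fun_prop)

end Spectral

/-! ### The Choi matrix and the action of `Φ ⊗ I_A` -/

section Choi

variable {n k ι : Type*} [Fintype n] [Fintype k] [Fintype ι]

theorem choi_apply [DecidableEq n] (Φ : Matrix n n ℂ →ₗ[ℂ] Matrix n n ℂ) (a i b j : n) :
    choi Φ (a, i) (b, j) = Φ (single i j 1) a b := by
  simp only [choi, Matrix.sum_apply, kroneckerMap_apply, single_apply]
  rw [Finset.sum_eq_single i, Finset.sum_eq_single j]
  · simp
  · intro c _ hc; simp [hc]
  · simp
  · intro c _ hc; simp [hc]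
  · simp

omit [Fintype k] in
theorem ampliate_apply_eq_sum [DecidableEq n] (Φ : Matrix n n ℂ →ₗ[ℂ] Matrix n n ℂ)
    (M : Matrix (n × k) (n × k) ℂ) (a b : n) (x y : k) :
    ampliate Φ k M (a, x) (b, y) = ∑ i, ∑ j, M (i, x) (j, y) * choi Φ (a, i) (b, j) := by
  have h : (Matrix.of fun i j => M (i, x) (j, y))
      = ∑ i, ∑ j, M (i, x) (j, y) • single i j (1 : ℂ) := by
    rw [matrix_eq_sum_single (Matrix.of fun i j => M (i, x) (j, y))]
    simp [smul_single]
  simp only [ampliate, of_apply]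
  rw [h]
  simp only [map_sum, map_smul, Matrix.sum_apply, Matrix.smul_apply, smul_eq_mul, choi_apply]

omit [Fintype n] [Fintype k] in
theorem ampliate_sub (E E' : Matrix n n ℂ →ₗ[ℂ] Matrix n n ℂ) (M : Matrix (n × k) (n × k) ℂ) :
    ampliate (E - E') k M = ampliate E k M - ampliate E' k M := by
  ext p q
  simp [ampliate]

/-- The operator `∑ l, |C l⟫⟪C l|` on `H ⊗ A`, where the matrix `C l` is read as the vector with
coordinate `C l x i` at the basis vector `(i, x)`. -/
def mixture (C : ι → Matrix k n ℂ) : Matrix (n × k) (n × k) ℂ :=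
  Matrix.of fun p q => ∑ l, C l p.2 p.1 * star (C l q.2 q.1)

/-- The transpose of the reduced operator on `H` of `mixture C`. -/
def mixtureMarginal (C : ι → Matrix k n ℂ) : Matrix n n ℂ :=
  ∑ l, (C l)ᴴ * C l

/-- The operator `I ⊗ C` from `H ⊗ H` to `H ⊗ A`. -/
abbrev lift [DecidableEq n] (C : Matrix k n ℂ) : Matrix (n × k) (n × n) ℂ :=
  (1 : Matrix n n ℂ) ⊗ₖ C

theorem lift_conjTranspose_mul_self [DecidableEq n] (C : Matrix k n ℂ) :
    (lift C)ᴴ * lift C = (1 : Matrix n n ℂ) ⊗ₖ (Cᴴ * C) := by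
  rw [lift, conjTranspose_kronecker, ← mul_kronecker_mul, conjTranspose_one, Matrix.one_mul]

omit [Fintype n] in
theorem one_kronecker_sum [DecidableEq n] (f : ι → Matrix n n ℂ) :
    (1 : Matrix n n ℂ) ⊗ₖ (∑ l, f l) = ∑ l, (1 : Matrix n n ℂ) ⊗ₖ f l := by
  ext p q
  simp [Matrix.sum_apply, Finset.mul_sum]

theorem mixture_posSemidef (C : ι → Matrix k n ℂ) : (mixture C).PosSemidef := by
  have h : mixture C = ∑ l, vecMulVec (fun p : n × k => C l p.2 p.1)
      (star fun p : n × k => C l p.2 p.1) := by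
    ext p q
    simp [mixture, Matrix.sum_apply, vecMulVec_apply]
  rw [h]
  exact posSemidef_sum _ fun l _ => posSemidef_vecMulVec_self_star _

theorem mixtureMarginal_posSemidef (C : ι → Matrix k n ℂ) : (mixtureMarginal C).PosSemidef :=
  posSemidef_sum _ fun l _ => posSemidef_conjTranspose_mul_self (C l)

theorem exists_eq_mixture [DecidableEq n] [DecidableEq k]
    {M : Matrix (n × k) (n × k) ℂ} (hM : M.PosSemidef) :
    ∃ C : n × k → Matrix k n ℂ, M = mixture C := by
  obtain ⟨V, rfl⟩ := exists_conjTranspose_mul_self hM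
  refine ⟨fun l => Matrix.of fun x i => star (V l (i, x)), ?_⟩
  ext p q
  simp [mixture, Matrix.mul_apply]

theorem trace_kronecker_one_mul_mixture [DecidableEq k] (Q : Matrix n n ℂ) (C : ι → Matrix k n ℂ) :
    ((Q ⊗ₖ (1 : Matrix k k ℂ)) * mixture C).trace = (Qᵀ * mixtureMarginal C).trace := by
  have hL : ((Q ⊗ₖ (1 : Matrix k k ℂ)) * mixture C).trace
      = ∑ i, ∑ x, ∑ j, ∑ l, Q i j * (C l x j * star (C l x i)) := by
    simp only [Matrix.trace, diag_apply, Matrix.mul_apply, Fintype.sum_prod_type,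
      kroneckerMap_apply, one_apply, mul_ite, mul_one, mul_zero, ite_mul, zero_mul,
      Finset.sum_ite_eq, Finset.mem_univ, if_true]
    simp only [mixture, of_apply, Finset.mul_sum]
  have hR : (Qᵀ * mixtureMarginal C).trace
      = ∑ j, ∑ i, ∑ l, ∑ x, Q i j * (star (C l x i) * C l x j) := by
    simp only [Matrix.trace, diag_apply, Matrix.mul_apply, mixtureMarginal, Matrix.sum_apply,
      transpose_apply, conjTranspose_apply, Finset.mul_sum]
    exact Finset.sum_congr rfl fun j _ => Finset.sum_comm
  rw [hL, hR, Finset.sum_comm (f := fun j i => ∑ l, ∑ x, Q i j * (star (C l x i) * C l x j))]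
  refine Finset.sum_congr rfl fun i _ => ?_
  rw [Finset.sum_comm]
  refine Finset.sum_congr rfl fun j _ => ?_
  rw [Finset.sum_comm]
  refine Finset.sum_congr rfl fun l _ => Finset.sum_congr rfl fun x _ => ?_
  rw [mul_comm (C l x j)]

theorem trace_mixture [DecidableEq n] [DecidableEq k] (C : ι → Matrix k n ℂ) :
    (mixture C).trace = (mixtureMarginal C).trace := by
  have := trace_kronecker_one_mul_mixture (1 : Matrix n n ℂ) C
  simpa using this

omit [Fintype k] in
/-- The output of `Φ ⊗ I_A` in terms of the Choi matrix. -/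
theorem ampliate_mixture [DecidableEq n] (Φ : Matrix n n ℂ →ₗ[ℂ] Matrix n n ℂ)
    (C : ι → Matrix k n ℂ) :
    ampliate Φ k (mixture C) = ∑ l, lift (C l) * choi Φ * (lift (C l))ᴴ := by
  ext ⟨a, x⟩ ⟨b, y⟩
  have hR : ∀ l, (lift (C l) * choi Φ * (lift (C l))ᴴ) (a, x) (b, y)
      = ∑ i, ∑ j, C l x i * choi Φ (a, i) (b, j) * star (C l y j) := by
    intro l
    rw [Finset.sum_comm]
    simp [lift, Matrix.mul_apply, Fintype.sum_prod_type, one_apply, Finset.sum_mul, apply_ite]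
  rw [ampliate_apply_eq_sum, Matrix.sum_apply]
  simp only [hR, mixture, of_apply, Finset.sum_mul]
  symm
  rw [Finset.sum_comm]
  refine Finset.sum_congr rfl fun i _ => ?_
  rw [Finset.sum_comm]
  refine Finset.sum_congr rfl fun j _ => Finset.sum_congr rfl fun l _ => ?_
  ring

/-- The value of the centered objective at `W = ∑ l, Tₗᴴ P Tₗ`, with `Tₗ = I ⊗ C l`. -/
theorem centered_objective_eq [DecidableEq n] [DecidableEq k]
    (Φ : Matrix n n ℂ →ₗ[ℂ] Matrix n n ℂ) (C : ι → Matrix k n ℂ)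
    (P : Matrix (n × k) (n × k) ℂ) :
    (choi Φ * (∑ l, (lift (C l))ᴴ * P * lift (C l)
        - (1 / 2 : ℂ) • ((1 : Matrix n n ℂ) ⊗ₖ mixtureMarginal C))).trace.re
      = (P * ampliate Φ k (mixture C)).trace.re
        - 1 / 2 * (ampliate Φ k (mixture C)).trace.re := by
  have h : ∀ R : Matrix (n × k) (n × k) ℂ,
      (choi Φ * ∑ l, (lift (C l))ᴴ * R * lift (C l)).trace
        = (R * ampliate Φ k (mixture C)).trace := by
    intro R
    rw [ampliate_mixture, Finset.mul_sum, Finset.mul_sum, trace_sum, trace_sum]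
    refine Finset.sum_congr rfl fun l _ => ?_
    rw [← Matrix.mul_assoc, Matrix.trace_mul_comm, ← Matrix.mul_assoc, ← Matrix.mul_assoc,
      Matrix.trace_mul_comm]
  have h1 : (1 : Matrix n n ℂ) ⊗ₖ mixtureMarginal C
      = ∑ l, (lift (C l))ᴴ * (1 : Matrix (n × k) (n × k) ℂ) * lift (C l) := by
    rw [mixtureMarginal, one_kronecker_sum]
    simp only [Matrix.mul_one, lift_conjTranspose_mul_self]
  rw [Matrix.mul_sub, Matrix.mul_smul, trace_sub, trace_smul, h1, h, h, Matrix.one_mul]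
  simp

end Choi

/-! ### The semidefinite programs -/

section Program

variable {n : Type*} [Fintype n] [DecidableEq n]

omit [DecidableEq n] in
theorem ampliate_sub_isHermitian {E E' : Matrix n n ℂ →ₗ[ℂ] Matrix n n ℂ}
    (hE : IsSuperoperator E) (hE' : IsSuperoperator E') {k : ℕ}
    {M : Matrix (n × Fin k) (n × Fin k) ℂ} (hM : M.PosSemidef) :
    (ampliate (E - E') (Fin k) M).IsHermitian := by
  rw [ampliate_sub]
  exact (hE.completelyPositive k M hM).isHermitian.sub (hE'.completelyPositive k M hM).isHermitian

/-- Every value of the trace distance is a value of the centered program: if `P` is an optimal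
effect for the output on `∑ l, |C l⟫⟪C l|`, take `W = ∑ l, (I ⊗ C l)ᴴ P (I ⊗ C l)`. -/
theorem qDiamondValues_subset_centeredSDPValues {E E' : Matrix n n ℂ →ₗ[ℂ] Matrix n n ℂ}
    (hE : IsSuperoperator E) (hE' : IsSuperoperator E') (Q : Matrix n n ℂ) (lam : ℝ) :
    qDiamondValues E E' Q lam
      ⊆ centeredSDPValues (densityOperators n) (choi (E - E')) Qᵀ lam := by
  rintro t ⟨k, M, ⟨hM, htr⟩, hQ, rfl⟩
  obtain ⟨P, hP, hP', hval⟩ := exists_effect_eq_traceNorm (ampliate_sub_isHermitian hE hE' hM)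
  obtain ⟨C, rfl⟩ := exists_eq_mixture hM
  refine ⟨mixtureMarginal C, ⟨mixtureMarginal_posSemidef C, by rw [← trace_mixture, htr]⟩,
    ∑ l, (lift (C l))ᴴ * P * lift (C l), ⟨?_, ?_, ?_⟩, ?_⟩
  · exact posSemidef_sum _ fun l _ => hP.conjTranspose_mul_mul_same _
  · have h : (1 : Matrix n n ℂ) ⊗ₖ mixtureMarginal C - ∑ l, (lift (C l))ᴴ * P * lift (C l)
        = ∑ l, (lift (C l))ᴴ * (1 - P) * lift (C l) := by
      rw [mixtureMarginal, one_kronecker_sum, ← Finset.sum_sub_distrib]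
      refine Finset.sum_congr rfl fun l _ => ?_
      rw [Matrix.mul_sub, Matrix.sub_mul, Matrix.mul_one, lift_conjTranspose_mul_self]
    rw [h]
    exact posSemidef_sum _ fun l _ => hP'.conjTranspose_mul_mul_same _
  · rwa [← trace_kronecker_one_mul_mixture]
  · rw [centered_objective_eq, hval, traceDist, ampliate_sub]

/-- Every value of the centered program is bounded by a trace distance, namely the one on
the purification `|C⟫⟪C|` of `ρᵀ`, for any `C` with `Cᴴ C = ρ`: by Douglas' lemma
`W = (I ⊗ C)ᴴ P (I ⊗ C)` for an effect `P`. -/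
theorem exists_qDiamondValue_ge {E E' : Matrix n n ℂ →ₗ[ℂ] Matrix n n ℂ}
    (hE : IsSuperoperator E) (hE' : IsSuperoperator E') {Q : Matrix n n ℂ} {lam v : ℝ}
    (hv : v ∈ centeredSDPValues (densityOperators n) (choi (E - E')) Qᵀ lam) :
    ∃ t ∈ qDiamondValues E E' Q lam, v ≤ t := by
  obtain ⟨ρ, ⟨hρ, htr⟩, W, ⟨hW, hWρ, hQ⟩, rfl⟩ := hv
  obtain ⟨V, rfl⟩ := exists_conjTranspose_mul_self hρ
  -- rows are renumbered because the auxiliary spaces are the `ℂᵏ` with basis `Fin k`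
  set C : Matrix (Fin (Fintype.card n)) n ℂ := V.submatrix (Fintype.equivFin n).symm id with hC
  have hCV : Vᴴ * V = Cᴴ * C := by
    rw [hC, conjTranspose_submatrix, submatrix_mul_equiv, submatrix_id_id]
  have hmarg : mixtureMarginal (fun _ : Unit => C) = Vᴴ * V := by
    rw [mixtureMarginal, hCV]; simp
  have hWT : ((lift C)ᴴ * lift C - W).PosSemidef := by
    rwa [lift_conjTranspose_mul_self, ← hCV]
  obtain ⟨P, hP, hP', rfl⟩ := exists_effect_factorization hW hWT
  have hM := mixture_posSemidef (fun _ : Unit => C)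
  refine ⟨_, ⟨Fintype.card n, mixture (fun _ : Unit => C), ⟨hM, ?_⟩, ?_, rfl⟩, ?_⟩
  · rw [trace_mixture, hmarg, htr]
  · rwa [trace_kronecker_one_mul_mixture, hmarg]
  · have h := centered_objective_eq (E - E') (fun _ : Unit => C) P
    simp only [Finset.univ_unique, Finset.sum_singleton, hmarg] at h
    rw [h, traceDist, ← ampliate_sub]
    exact centered_trace_le_traceNorm (ampliate_sub_isHermitian hE hE' hM) hP hP'

theorem isCompact_setOf_entries_le_one (m : Type*) [Fintype m] :
    IsCompact {M : Matrix m m ℂ | ∀ i j, ‖M i j‖ ≤ 1} := by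
  have h : {M : Matrix m m ℂ | ∀ i j, ‖M i j‖ ≤ 1} = Set.pi Set.univ fun _ : m =>
      Set.pi Set.univ fun _ : m => Metric.closedBall (0 : ℂ) 1 := by
    apply Set.ext
    exact fun M => ⟨fun h i _ j _ => mem_closedBall_zero_iff.mpr (h i j),
      fun h i j => mem_closedBall_zero_iff.mp (h i trivial j trivial)⟩
  rw [h]
  exact isCompact_univ_pi fun _ => isCompact_univ_pi fun _ => isCompact_closedBall _ _

omit [Fintype n] in
theorem continuous_one_kronecker :
    Continuous fun ρ : Matrix n n ℂ => (1 : Matrix n n ℂ) ⊗ₖ ρ :=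
  continuous_pi fun p => continuous_pi fun q => by
    simp only [kroneckerMap_apply]
    fun_prop

/-- The feasible set of the program with density operators is compact: all entries of `ρ` and of
`W ⊑ I ⊗ ρ` are bounded by the trace of `ρ`. -/
theorem isCompact_setOf_feasible (P : Matrix n n ℂ) (lam : ℝ) :
    IsCompact {x : Matrix n n ℂ × Matrix (n × n) (n × n) ℂ |
      x.1 ∈ densityOperators n ∧ SDPConstraints P lam x.1 x.2} := by
  refine ((isCompact_setOf_entries_le_one n).prod
    (isCompact_setOf_entries_le_one (n × n))).of_isClosed_subset ?_ ?_
  · have h1 : IsClosed {x : Matrix n n ℂ × Matrix (n × n) (n × n) ℂ | x.1.PosSemidef} :=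
      isClosed_posSemidef.preimage continuous_fst
    have h2 : IsClosed {x : Matrix n n ℂ × Matrix (n × n) (n × n) ℂ | x.1.trace = 1} :=
      isClosed_eq (by fun_prop) continuous_const
    have h3 : IsClosed {x : Matrix n n ℂ × Matrix (n × n) (n × n) ℂ | x.2.PosSemidef} :=
      isClosed_posSemidef.preimage continuous_snd
    have h4 : IsClosed {x : Matrix n n ℂ × Matrix (n × n) (n × n) ℂ |
        ((1 : Matrix n n ℂ) ⊗ₖ x.1 - x.2).PosSemidef} :=
      isClosed_posSemidef.preimage
        ((continuous_one_kronecker.comp continuous_fst).sub continuous_snd)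
    have h5 : IsClosed {x : Matrix n n ℂ × Matrix (n × n) (n × n) ℂ |
        lam ≤ (P * x.1).trace.re} :=
      isClosed_le continuous_const (by fun_prop)
    exact (h1.inter h2).inter (h3.inter (h4.inter h5))
  · rintro ⟨ρ, W⟩ ⟨⟨hρ, htr⟩, hW, hWρ, -⟩
    have hdiag : ∀ i, (ρ i i).re ≤ 1 := by
      intro i
      have h := congrArg Complex.re htr
      rw [Matrix.trace, Complex.re_sum, Complex.one_re] at h
      rw [← h]
      exact Finset.single_le_sum (f := fun i => (ρ i i).re)
        (fun j _ => (Complex.le_def.mp hρ.diag_nonneg).1) (Finset.mem_univ i)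
    refine ⟨norm_entry_le_one hρ hdiag, norm_entry_le_one hW fun p => ?_⟩
    have h := (Complex.le_def.mp (hWρ.diag_nonneg (i := p))).1
    simp only [Matrix.sub_apply, kroneckerMap_apply, one_apply_eq, one_mul, Complex.sub_re,
      Complex.zero_re, sub_nonneg] at h
    exact h.trans (hdiag p.2)

theorem exists_isGreatest_centeredSDPValues (J : Matrix (n × n) (n × n) ℂ) {P : Matrix n n ℂ}
    {lam : ℝ} (hfeas : ∃ ρ ∈ densityOperators n, lam ≤ (P * ρ).trace.re) :
    ∃ v, IsGreatest (centeredSDPValues (densityOperators n) J P lam) v := by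
  obtain ⟨ρ₀, hρ₀, hlam⟩ := hfeas
  have hcont : Continuous fun x : Matrix n n ℂ × Matrix (n × n) (n × n) ℂ =>
      (J * (x.2 - (1 / 2 : ℂ) • ((1 : Matrix n n ℂ) ⊗ₖ x.1))).trace.re := by
    have h1 : Continuous fun x : Matrix n n ℂ × Matrix (n × n) (n × n) ℂ =>
        (1 : Matrix n n ℂ) ⊗ₖ x.1 := continuous_one_kronecker.comp continuous_fst
    fun_prop
  have hW₀ : SDPConstraints P lam ρ₀ 0 :=
    ⟨PosSemidef.zero, by rw [sub_zero]; exact PosSemidef.one.kronecker hρ₀.1, hlam⟩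
  obtain ⟨⟨ρ, W⟩, ⟨hρ, hW⟩, hmax⟩ := (isCompact_setOf_feasible P lam).exists_isMaxOn
    ⟨(ρ₀, 0), hρ₀, hW₀⟩ hcont.continuousOn
  refine ⟨_, ⟨ρ, hρ, W, hW, rfl⟩, ?_⟩
  rintro v ⟨ρ', hρ', W', hW', rfl⟩
  exact isMaxOn_iff.mp hmax (ρ', W') ⟨hρ', hW'⟩

/-- A feasible pair with a partial density operator is completed to one with a density operator
without decreasing the centered objective: add a multiple `τ` of a density operator to `ρ`, and add
to `W` either `0` or `I ⊗ τ`, whichever makes the change `± ½ tr(J (I ⊗ τ))` nonnegative. -/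
theorem exists_centeredSDPValue_ge_of_partial {J : Matrix (n × n) (n × n) ℂ} {P : Matrix n n ℂ}
    (hP : P.PosSemidef) {lam v : ℝ} (hne : (densityOperators n).Nonempty)
    (hv : v ∈ centeredSDPValues (partialDensityOperators n) J P lam) :
    ∃ w ∈ centeredSDPValues (densityOperators n) J P lam, v ≤ w := by
  obtain ⟨σ, hσ, hσtr⟩ := hne
  obtain ⟨ρ, ⟨hρ, htr⟩, W, ⟨hW, hWρ, hlam⟩, rfl⟩ := hv
  set τ : Matrix n n ℂ := ((1 - ρ.trace.re : ℝ) : ℂ) • σ with hτdef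
  have hτ : τ.PosSemidef :=
    hσ.smul (by rw [Complex.zero_le_real]; linarith)
  have hIτ : ((1 : Matrix n n ℂ) ⊗ₖ τ).PosSemidef := PosSemidef.one.kronecker hτ
  have hdens : ρ + τ ∈ densityOperators n := by
    refine ⟨hρ.add hτ, ?_⟩
    have him := (Complex.le_def.mp hρ.trace_nonneg).2
    rw [trace_add, hτdef, trace_smul, hσtr]
    apply Complex.ext
    · simp
    · simpa using him.symm
  have hlam' : lam ≤ (P * (ρ + τ)).trace.re := by
    rw [Matrix.mul_add, trace_add, Complex.add_re]
    linarith [trace_mul_nonneg hP hτ]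
  rcases le_total 0 (J * ((1 : Matrix n n ℂ) ⊗ₖ τ)).trace.re with h | h
  · refine ⟨_, ⟨ρ + τ, hdens, W + (1 : Matrix n n ℂ) ⊗ₖ τ, ⟨hW.add hIτ, ?_, hlam'⟩, rfl⟩, ?_⟩
    · rwa [kronecker_add, add_sub_add_right_eq_sub]
    · have h1 : J * (W + (1 : Matrix n n ℂ) ⊗ₖ τ - (1 / 2 : ℂ) • ((1 : Matrix n n ℂ) ⊗ₖ (ρ + τ)))
          = J * (W - (1 / 2 : ℂ) • ((1 : Matrix n n ℂ) ⊗ₖ ρ))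
            + ((1 / 2 : ℝ) : ℂ) • (J * ((1 : Matrix n n ℂ) ⊗ₖ τ)) := by
        rw [← Matrix.mul_smul, ← Matrix.mul_add, kronecker_add]
        congr 1
        push_cast
        module
      rw [h1, trace_add, trace_smul, Complex.add_re, smul_eq_mul, Complex.re_ofReal_mul]
      linarith
  · refine ⟨_, ⟨ρ + τ, hdens, W, ⟨hW, ?_, hlam'⟩, rfl⟩, ?_⟩
    · rw [kronecker_add, add_sub_right_comm]
      exact hWρ.add hIτ
    · have h1 : J * (W - (1 / 2 : ℂ) • ((1 : Matrix n n ℂ) ⊗ₖ (ρ + τ)))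
          = J * (W - (1 / 2 : ℂ) • ((1 : Matrix n n ℂ) ⊗ₖ ρ))
            - ((1 / 2 : ℝ) : ℂ) • (J * ((1 : Matrix n n ℂ) ⊗ₖ τ)) := by
        rw [← Matrix.mul_smul, ← Matrix.mul_sub, kronecker_add]
        congr 1
        push_cast
        module
      rw [h1, trace_sub, trace_smul, Complex.sub_re, smul_eq_mul, Complex.re_ofReal_mul]
      linarith

theorem trace_choi_mul_one_kronecker {Φ : Matrix n n ℂ →ₗ[ℂ] Matrix n n ℂ}
    (hΦ : ∀ X, (Φ X).trace = 0) (ρ : Matrix n n ℂ) :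
    (choi Φ * ((1 : Matrix n n ℂ) ⊗ₖ ρ)).trace = 0 := by
  simp only [choi, Finset.sum_mul, trace_sum, ← mul_kronecker_mul, trace_kronecker, Matrix.mul_one,
    hΦ, zero_mul, Finset.sum_const_zero]

/-- Centering does not matter if `Φ` has traceless outputs, since then `tr(J(Φ) (I ⊗ ρ)) = 0`. -/
theorem centeredSDPValues_eq_sdpValues {Φ : Matrix n n ℂ →ₗ[ℂ] Matrix n n ℂ}
    (hΦ : ∀ X, (Φ X).trace = 0) (D : Set (Matrix n n ℂ)) (P : Matrix n n ℂ) (lam : ℝ) :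
    centeredSDPValues D (choi Φ) P lam = sdpValues D (choi Φ) P lam := by
  have h : ∀ (ρ : Matrix n n ℂ) (W : Matrix (n × n) (n × n) ℂ),
      (choi Φ * (W - (1 / 2 : ℂ) • ((1 : Matrix n n ℂ) ⊗ₖ ρ))).trace.re
        = (choi Φ * W).trace.re := by
    intro ρ W
    rw [Matrix.mul_sub, Matrix.mul_smul, trace_sub, trace_smul, trace_choi_mul_one_kronecker hΦ,
      smul_zero, sub_zero]
  simp only [centeredSDPValues, sdpValues, h]

omit [DecidableEq n] in
theorem densityOperators_subset_partialDensityOperators :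
    densityOperators n ⊆ partialDensityOperators n :=
  fun _ h => ⟨h.1, by simp [h.2]⟩

end Program

end QDiamond

theorem mainTheorem6 {n : Type*} [Fintype n] [DecidableEq n]
    (E E' : Matrix n n ℂ →ₗ[ℂ] Matrix n n ℂ)
    (hE : QDiamond.IsSuperoperator E) (hE' : QDiamond.IsSuperoperator E')
    (Q : Matrix n n ℂ) (hQ : QDiamond.IsQuantumPredicate Q)
    (lam : ℝ) (hlam0 : 0 ≤ lam) (hlam1 : lam ≤ 1)
    (hfeas : ∃ ρ ∈ QDiamond.densityOperators n, lam ≤ (Q * ρ).trace.re) :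
    -- the maximum defining the norm is attained
    IsGreatest (QDiamond.qDiamondValues E E' Q lam) (QDiamond.qDiamondNorm E E' Q lam) ∧
    -- superoperators whose outputs have equal traces, for instance trace-preserving ones
    ((∀ X : Matrix n n ℂ, (E X).trace = (E' X).trace) →
      IsGreatest (QDiamond.sdpValues (QDiamond.densityOperators n)
        (QDiamond.choi (E - E')) Q.transpose lam) (QDiamond.qDiamondNorm E E' Q lam) ∧
      IsGreatest (QDiamond.sdpValues (QDiamond.partialDensityOperators n)
        (QDiamond.choi (E - E')) Q.transpose lam) (QDiamond.qDiamondNorm E E' Q lam)) ∧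
    -- arbitrary superoperators
    (IsGreatest (QDiamond.centeredSDPValues (QDiamond.densityOperators n)
        (QDiamond.choi (E - E')) Q.transpose lam) (QDiamond.qDiamondNorm E E' Q lam) ∧
      IsGreatest (QDiamond.centeredSDPValues (QDiamond.partialDensityOperators n)
        (QDiamond.choi (E - E')) Q.transpose lam) (QDiamond.qDiamondNorm E E' Q lam)) := by
  obtain ⟨ρ₀, hρ₀, hlam⟩ := hfeas
  have hfeasT : ∃ ρ ∈ QDiamond.densityOperators n, lam ≤ (Q.transpose * ρ).trace.re := by
    refine ⟨ρ₀.transpose, ⟨hρ₀.1.transpose, by rw [Matrix.trace_transpose, hρ₀.2]⟩, ?_⟩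
    rwa [← Matrix.transpose_mul, Matrix.trace_transpose, Matrix.trace_mul_comm]
  obtain ⟨v, hvmem, hvmax⟩ :=
    QDiamond.exists_isGreatest_centeredSDPValues (QDiamond.choi (E - E')) hfeasT
  have hnorm : IsGreatest (QDiamond.qDiamondValues E E' Q lam) v := by
    have hsub := QDiamond.qDiamondValues_subset_centeredSDPValues hE hE' Q lam
    obtain ⟨t, ht, hvt⟩ := QDiamond.exists_qDiamondValue_ge hE hE' hvmem
    have htv : t = v := le_antisymm (hvmax (hsub ht)) hvt
    exact ⟨htv ▸ ht, fun s hs => hvmax (hsub hs)⟩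
  have hv : QDiamond.qDiamondNorm E E' Q lam = v := hnorm.csSup_eq
  have hpartial : IsGreatest (QDiamond.centeredSDPValues (QDiamond.partialDensityOperators n)
      (QDiamond.choi (E - E')) Q.transpose lam) v := by
    constructor
    · obtain ⟨ρ, hρ, W, hW⟩ := hvmem
      exact ⟨ρ, QDiamond.densityOperators_subset_partialDensityOperators hρ, W, hW⟩
    · intro w hw
      obtain ⟨u, hu, hwu⟩ :=
        QDiamond.exists_centeredSDPValue_ge_of_partial hQ.1.transpose ⟨ρ₀, hρ₀⟩ hw
      exact hwu.trans (hvmax hu)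
  rw [hv]
  refine ⟨hnorm, fun htr => ?_, ⟨hvmem, hvmax⟩, hpartial⟩
  have hΦ : ∀ X, ((E - E') X).trace = 0 := fun X => by
    rw [LinearMap.sub_apply, Matrix.trace_sub, htr, sub_self]
  rw [← QDiamond.centeredSDPValues_eq_sdpValues hΦ, ← QDiamond.centeredSDPValues_eq_sdpValues hΦ]
  exact ⟨⟨hvmem, hvmax⟩, hpartial⟩
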